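/- Let $\mathbf{F}_n(G)$ denote the group (under pointwise multiplication) of all word maps $G^n\to G$ in $n$ variables on a group $G$, and let $x_1\in\mathbf{F}_n(G)$ be the word map $(g_1,\dots,g_n)\mapsto g_1$. A *reduced free group* is a group isomorphic to $F/V(F)$, where $F$ is a free group, $V$ is a set of words and $V(F)$ is the subgroup generated by all values of the words of $V$ in $F$. For word maps $u,v\in\mathbf{F}_n(G)$, say that $v$ is a *homomorphic image* of $u$ if some endomorphism of $\mathbf{F}_n(G)$ takes $u$ to $v$, and that $u$ and $v$ are *related via an automorphism* if some automorphism of $\mathbf{F}_n(G)$ takes $u$ to $v$. There is a finite reduced free group over which two word maps are homomorphic images of each other but are not related via an automorphism. More precisely: 1. there is a finite reduced free group that is not nilpotent; 2. for every finite non-nilpotent reduced free group $G$ and every $n\ge 2$ there is a word map $w\in\mathbf{F}_n(G)$ such that $w:G^n\to G$ is surjective, the distribution $\mu_{G,w}(g)=|w^{-1}(g)|/|G|^n$ induced by $w$ on $G$ is not uniform, $w$ and $x_1$ are homomorphic images of each other, and $w$ and $x_1$ are not related via an automorphism. -/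

import Mathlib

universe u

namespace WordMaps

/-- The word map on `G` in the variables `x₁, …, xₙ` (indexed by `Fin n`): a word
`w` of the free group is sent to the map `(g₁, …, gₙ) ↦ w(g₁, …, gₙ)`. As a function of `w` it is a
homomorphism into the group of all maps `Gⁿ → G` with pointwise multiplication. -/
def wordMap (n : ℕ) (G : Type*) [Group G] : FreeGroup (Fin n) →* ((Fin n → G) → G) where
  toFun w := fun g => FreeGroup.lift g w
  map_one' := by
    funext g
    simp
  map_mul' v w := by
    funext g
    simp

/-- The group `𝐅ₙ(G)` of all `n`-variable word maps on `G`, under pointwise multiplication. -/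
def wordMapGroup (n : ℕ) (G : Type*) [Group G] : Subgroup ((Fin n → G) → G) :=
  (wordMap n G).range

/-- The word map of the `i`-th variable, as an element of `𝐅ₙ(G)`. -/
def varMap {n : ℕ} (G : Type*) [Group G] (i : Fin n) : wordMapGroup n G :=
  ⟨wordMap n G (FreeGroup.of i), ⟨FreeGroup.of i, rfl⟩⟩

/-- The distribution induced on a finite group `G` by a map `w : Gⁿ → G`:
`μ(g) = |w⁻¹(g)| / |G|ⁿ`. -/
noncomputable def distribution {n : ℕ} {G : Type*} (w : (Fin n → G) → G) (g : G) : ℚ :=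
  (Nat.card {a : Fin n → G // w a = g} : ℚ) / (Nat.card G : ℚ) ^ n

/-- `w` induces the uniform distribution on the finite group `G`. -/
def IsUniform {n : ℕ} {G : Type*} (w : (Fin n → G) → G) : Prop :=
  ∀ g : G, distribution w g = 1 / (Nat.card G : ℚ)

/-- The word map `v` is a homomorphic image of the word map `u`: some endomorphism of `𝐅ₙ(G)`
takes `u` to `v`. -/
def IsHomImage {n : ℕ} {G : Type*} [Group G] (v u : wordMapGroup n G) : Prop :=
  ∃ φ : wordMapGroup n G →* wordMapGroup n G, φ u = v

/-- The word maps `u` and `v` are related via an automorphism of `𝐅ₙ(G)`. -/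
def AreAutomorphic {n : ℕ} {G : Type*} [Group G] (u v : wordMapGroup n G) : Prop :=
  ∃ φ : wordMapGroup n G ≃* wordMapGroup n G, φ u = v

/-- The verbal subgroup `V(F)` of a group `F` for a set `V` of words (in countably many variables):
the subgroup generated by all values of the words of `V` in `F`. -/
def verbalSubgroup (V : Set (FreeGroup ℕ)) (F : Type*) [Group F] : Subgroup F :=
  Subgroup.closure {g | ∃ v ∈ V, ∃ f : ℕ → F, FreeGroup.lift f v = g}

instance verbalSubgroup_normal (V : Set (FreeGroup ℕ)) (F : Type*) [Group F] :
    (verbalSubgroup V F).Normal := by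
  refine ⟨fun g hg c => ?_⟩
  have hle : verbalSubgroup V F ≤ (verbalSubgroup V F).comap (MulAut.conj c).toMonoidHom := by
    refine (Subgroup.closure_le _).2 ?_
    rintro g ⟨v, hv, f, rfl⟩
    refine Subgroup.subset_closure ⟨v, hv, fun i => c * f i * c⁻¹, ?_⟩
    have h : FreeGroup.lift (fun i => c * f i * c⁻¹)
        = (MulAut.conj c).toMonoidHom.comp (FreeGroup.lift f) := by
      ext i
      simp
    rw [h]
    rfl
  simpa using hle hg

/-- `G` is a reduced free (relatively free) group: it is isomorphic to `F / V(F)` for some free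
group `F` (on a set `X`) and some set `V` of words, that is, `G` is the free group on `X` in the
variety of groups defined by the laws `V`. -/
def IsReducedFree (G : Type u) [Group G] : Prop :=
  ∃ (X : Type u) (V : Set (FreeGroup ℕ)),
    Nonempty (G ≃* FreeGroup X ⧸ verbalSubgroup V (FreeGroup X))

end WordMaps

namespace WordMaps

/-! ### Nilpotency and commuting elements of coprime order. -/

section Nilpotent

/-! The word `w(x, y) = (x y⁻ᴺ)ᴺ⁺¹ (yᴺ x⁻¹ y)ᴺ` satisfies `w(x, 1) = x` and `w(1, y) = 1`. By the
first identity, sending every variable but `x₁` to `1` takes `w` to `x₁`; conversely `x₁` maps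
anywhere. By the second, the fibre of `w` over `1` contains that of `x₁`. A non-nilpotent finite
group has non-commuting elements of coprime order, and these give an `N` for which the inclusion is
strict, so `w` is not uniform. Automorphisms of `𝐅ₙ(G)` permute `Gⁿ` and so preserve distributions,
while `x₁` is uniform. For existence, `𝐅₂(S₃)` is finite, reduced free, and maps onto `S₃`. -/

/-- A finite group in which elements of coprime order commute is nilpotent. -/
theorem isNilpotent_of_commute_of_coprime {G : Type*} [Group G] [Finite G]
    (h : ∀ x y : G, (orderOf x).Coprime (orderOf y) → Commute x y) : Group.IsNilpotent G := by
  refine (Group.isNilpotent_of_finite_tfae.out 0 3 rfl rfl).mpr ?_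
  intro p hp P
  rw [← Subgroup.normalizer_eq_top_iff, ← Subgroup.index_eq_one]
  by_contra hne
  obtain ⟨q, hq, hqd⟩ := Nat.exists_prime_and_dvd hne
  have : Fact q.Prime := ⟨hq⟩
  -- A Sylow `p`-subgroup already lies in its normalizer; for `q ≠ p`, a Sylow `q`-subgroup
  -- centralizes `P`. Either way `q` cannot divide the index.
  by_cases hqp : q = p
  · subst hqp
    exact P.not_dvd_index (hqd.trans (Subgroup.index_dvd_of_le Subgroup.le_normalizer))
  · obtain ⟨Q⟩ : Nonempty (Sylow q G) := inferInstance
    have hQ : (Q : Subgroup G) ≤ Subgroup.normalizer ((P : Subgroup G) : Set G) := by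
      refine le_trans (fun y hy => ?_) (Subgroup.centralizer_le_normalizer _)
      refine Subgroup.mem_centralizer_iff.2 fun x hx => h x y ?_
      obtain ⟨k, hk⟩ := IsPGroup.iff_orderOf.1 P.isPGroup' ⟨x, hx⟩
      obtain ⟨l, hl⟩ := IsPGroup.iff_orderOf.1 Q.isPGroup' ⟨y, hy⟩
      rw [Subgroup.orderOf_mk] at hk hl
      rw [hk, hl]
      exact Nat.Coprime.pow _ _ ((Nat.coprime_primes hp.out hq).2 (Ne.symm hqp))
    exact Q.not_dvd_index (hqd.trans (Subgroup.index_dvd_of_le hQ))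

/-- The center of the symmetric group on three letters is trivial, so that it is not nilpotent. -/
theorem not_isNilpotent_perm_fin_three : ¬ Group.IsNilpotent (Equiv.Perm (Fin 3)) := by
  intro h
  refine Group.IsNilpotent.center_ne_bot (G := Equiv.Perm (Fin 3)) ?_
  refine (Subgroup.eq_bot_iff_forall _).2 fun x hx => ?_
  rw [Subgroup.mem_center_iff] at hx
  revert x
  decide

end Nilpotent

/-! ### The collapsing word and its extra zero. -/

section Collapsing

/-- The word `(x y⁻ᴺ)ᴺ⁺¹ (yᴺ x⁻¹ y)ᴺ`. -/
def collapsingWord {H : Type*} [Group H] (N : ℕ) (x y : H) : H :=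
  (x * (y ^ N)⁻¹) ^ (N + 1) * (y ^ N * x⁻¹ * y) ^ N

theorem map_collapsingWord {H K : Type*} [Group H] [Group K] (f : H →* K) (N : ℕ) (x y : H) :
    f (collapsingWord N x y) = collapsingWord N (f x) (f y) := by
  simp [collapsingWord]

theorem collapsingWord_one_right {H : Type*} [Group H] (N : ℕ) (x : H) :
    collapsingWord N x 1 = x := by
  simp [collapsingWord, pow_succ']

theorem collapsingWord_one_left {H : Type*} [Group H] (N : ℕ) (y : H) :
    collapsingWord N 1 y = 1 := by
  simp only [collapsingWord, one_mul, inv_one, mul_one, inv_pow, ← pow_succ, ← pow_mul]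
  rw [mul_comm N (N + 1), inv_mul_cancel]

/-- If `G` is not nilpotent then some word `collapsingWord N` has a zero whose first coordinate is
nontrivial. -/
theorem exists_collapsingWord_eq_one {G : Type*} [Group G] [Finite G]
    (hG : ¬ Group.IsNilpotent G) :
    ∃ (N : ℕ) (z y : G), z ≠ 1 ∧ collapsingWord N z y = 1 := by
  obtain ⟨x, y, hxy, hcomm⟩ : ∃ x y : G, (orderOf x).Coprime (orderOf y) ∧ ¬ Commute x y := by
    by_contra! h
    exact hG (isNilpotent_of_commute_of_coprime h)
  -- `N ≡ -1` modulo the order of `x` and `N ≡ 0` modulo that of `y`.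
  obtain ⟨N, hNx, hNy⟩ := Nat.chineseRemainder hxy (orderOf x - 1) 0
  have hx : x ^ (N + 1) = 1 := by
    refine orderOf_dvd_iff_pow_eq_one.1 ((Nat.modEq_zero_iff_dvd).1 ?_)
    have h := hNx.add_right 1
    rw [Nat.sub_add_cancel (orderOf_pos x)] at h
    exact h.trans ((Nat.modEq_zero_iff_dvd).2 dvd_rfl)
  have hy : y ^ N = 1 := orderOf_dvd_iff_pow_eq_one.1 ((Nat.modEq_zero_iff_dvd).1 hNy)
  -- Chosen so that the two bases in the word become `x` and `y`, with value `xᴺ⁺¹ yᴺ = 1`.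
  refine ⟨N, x * (x * y) ^ N, x * y, fun h => hcomm ?_, ?_⟩
  · have h1 : Commute x (x * y) := by
      have h2 := ((Commute.refl (x * y)).pow_left N).inv_left
      rwa [← eq_inv_of_mul_eq_one_left h] at h2
    simpa using ((Commute.refl x).inv_right).mul_right h1
  · have e : (x * y) ^ N * (x * (x * y) ^ N)⁻¹ * (x * y) = y := by group
    rw [collapsingWord, e, mul_inv_cancel_right, hx, hy, one_mul]

end Collapsing

/-! ### Endomorphisms of `𝐅ₙ(G)` and distributions. -/

section WordMapGroup

variable {n : ℕ} {G : Type*} [Group G]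

/-- Evaluation of word maps at a tuple. -/
def evalHom (g : Fin n → G) : wordMapGroup n G →* G :=
  (Pi.evalMonoidHom _ g).comp (wordMapGroup n G).subtype

theorem evalHom_apply (g : Fin n → G) (f : wordMapGroup n G) :
    evalHom g f = (f : (Fin n → G) → G) g := rfl

theorem varMap_apply (i : Fin n) (g : Fin n → G) :
    (varMap G i : (Fin n → G) → G) g = g i := by
  simp [varMap, wordMap]

/-- Two homomorphisms on `𝐅ₙ(G)` that agree on the variables are equal. -/
theorem hom_ext {K : Type*} [Group K] {φ ψ : wordMapGroup n G →* K}
    (h : ∀ i, φ (varMap G i) = ψ (varMap G i)) : φ = ψ := by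
  refine (MonoidHom.cancel_right (wordMap n G).rangeRestrict_surjective).1 ?_
  exact FreeGroup.ext_hom _ _ h

/-- An endomorphism of `𝐅ₙ(G)` is the substitution of the images of the variables. -/
theorem endomorphism_apply (φ : wordMapGroup n G →* wordMapGroup n G) (f : wordMapGroup n G)
    (g : Fin n → G) : (φ f : (Fin n → G) → G) g =
      (f : (Fin n → G) → G) fun i => (φ (varMap G i) : (Fin n → G) → G) g := by
  have h : (evalHom g).comp φ =
      evalHom fun i => (φ (varMap G i) : (Fin n → G) → G) g :=
    hom_ext fun i => by simp [evalHom_apply, varMap_apply]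
  exact DFunLike.congr_fun h f

/-- The endomorphism of `𝐅ₙ(G)` substituting given word maps for the variables. -/
def substitution (u : Fin n → wordMapGroup n G) : wordMapGroup n G →* wordMapGroup n G where
  toFun f := ⟨fun g => (f : (Fin n → G) → G) fun i => (u i : (Fin n → G) → G) g, by
    obtain ⟨_, w, rfl⟩ := f
    have h : (fun g => wordMap n G w fun i => (u i : (Fin n → G) → G) g) =
        (FreeGroup.lift u w : wordMapGroup n G) := by
      funext g
      have e : FreeGroup.lift (fun i => (u i : (Fin n → G) → G) g) =
          (evalHom g).comp (FreeGroup.lift u) := by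
        ext i
        simp [evalHom_apply]
      exact DFunLike.congr_fun e w
    change (fun g => wordMap n G w fun i => (u i : (Fin n → G) → G) g) ∈ wordMapGroup n G
    rw [h]
    exact SetLike.coe_mem _⟩
  map_one' := rfl
  map_mul' _ _ := rfl

theorem substitution_varMap (u : Fin n → wordMapGroup n G) (i : Fin n) :
    substitution u (varMap G i) = u i := by
  ext g
  exact varMap_apply i _

/-- Every word map is a homomorphic image of every variable. -/
theorem isHomImage_varMap (w : wordMapGroup n G) (i : Fin n) : IsHomImage w (varMap G i) :=
  ⟨substitution fun _ => w, substitution_varMap _ i⟩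

/-- A word map of which a variable is a homomorphic image is surjective. -/
theorem IsHomImage.surjective {w : wordMapGroup n G} {i : Fin n}
    (h : IsHomImage (varMap G i) w) : Function.Surjective (w : (Fin n → G) → G) := by
  obtain ⟨φ, hφ⟩ := h
  -- Evaluating `φ w = xᵢ` at the constant tuple `g` shows that `w` takes the value `g`.
  refine fun g => ⟨fun j => (φ (varMap G j) : (Fin n → G) → G) fun _ => g, ?_⟩
  rw [← endomorphism_apply, hφ, varMap_apply]

/-- The permutation of `Gⁿ` given by an automorphism of `𝐅ₙ(G)`. -/
def tupleEquiv (φ : wordMapGroup n G ≃* wordMapGroup n G) : (Fin n → G) ≃ (Fin n → G) where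
  toFun g i := (φ (varMap G i) : (Fin n → G) → G) g
  invFun g i := (φ.symm (varMap G i) : (Fin n → G) → G) g
  left_inv g := by
    funext i
    have h := endomorphism_apply φ.toMonoidHom (φ.symm (varMap G i)) g
    simpa [varMap_apply] using h.symm
  right_inv g := by
    funext i
    have h := endomorphism_apply φ.symm.toMonoidHom (φ (varMap G i)) g
    simpa [varMap_apply] using h.symm

/-- Word maps related via an automorphism induce the same distribution. -/
theorem AreAutomorphic.distribution_eq {u v : wordMapGroup n G} (h : AreAutomorphic u v) (g : G) :
    distribution (v : (Fin n → G) → G) g = distribution (u : (Fin n → G) → G) g := by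
  obtain ⟨φ, rfl⟩ := h
  have e : {a : Fin n → G // (φ u : (Fin n → G) → G) a = g} ≃
      {a : Fin n → G // (u : (Fin n → G) → G) a = g} :=
    (tupleEquiv φ).subtypeEquiv fun a => by
      rw [show (φ u : (Fin n → G) → G) a = (u : (Fin n → G) → G) (tupleEquiv φ a) from
        endomorphism_apply φ.toMonoidHom u a]
  rw [distribution, distribution, Nat.card_congr e]

/-- The variables induce the uniform distribution. -/
theorem isUniform_varMap [Finite G] (i : Fin n) : IsUniform (varMap G i : (Fin n → G) → G) := by
  intro g
  -- Overwriting coordinate `i` by `g` and remembering its old value gives `Gⁿ ≃ fibre × G`.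
  have e : (Fin n → G) ≃ {a : Fin n → G // (varMap G i : (Fin n → G) → G) a = g} × G :=
    { toFun := fun a => (⟨Function.update a i g, by simp [varMap_apply]⟩, a i)
      invFun := fun b => Function.update b.1.1 i b.2
      left_inv := fun a => by simp
      right_inv := fun b => by
        obtain ⟨⟨a, ha⟩, c⟩ := b
        rw [varMap_apply] at ha
        subst ha
        simp }
  have hc := Nat.card_congr e
  rw [Nat.card_prod, Nat.card_fun, Nat.card_fin] at hc
  have hG : (Nat.card G : ℚ) ≠ 0 := Nat.cast_ne_zero.2 Nat.card_pos.ne'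
  rw [distribution, div_eq_div_iff (pow_ne_zero _ hG) hG, one_mul]
  exact_mod_cast hc.symm

/-- A word map vanishing wherever a variable does, and at some further tuple, is not uniform. -/
theorem not_isUniform_of_zero [Finite G] (i : Fin n) {w : (Fin n → G) → G}
    (h : ∀ a : Fin n → G, a i = 1 → w a = 1) {a : Fin n → G} (ha : a i ≠ 1) (hw : w a = 1) :
    ¬ IsUniform w := by
  intro hu
  have hG : (Nat.card G : ℚ) ≠ 0 := Nat.cast_ne_zero.2 Nat.card_pos.ne'
  have heq := (hu 1).trans (isUniform_varMap (G := G) i 1).symm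
  rw [distribution, distribution, div_left_inj' (pow_ne_zero _ hG), Nat.cast_inj] at heq
  have hss : {b | (varMap G i : (Fin n → G) → G) b = 1} ⊂ {b | w b = 1} := by
    refine Set.ssubset_iff_exists.2 ⟨fun b hb => h b ?_, a, hw, fun hb => ha ?_⟩
    · rwa [Set.mem_ofPred_eq, varMap_apply] at hb
    · rwa [Set.mem_ofPred_eq, varMap_apply] at hb
  exact (Set.ncard_lt_ncard hss (Set.toFinite _)).ne' heq

end WordMapGroup

/-! ### Groups of word maps are reduced free. -/

section ReducedFree

variable (n : ℕ) (G : Type*) [Group G]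

/-- The kernel of the word map homomorphism is the verbal subgroup given by the laws of `G`. -/
theorem ker_wordMap : (wordMap n G).ker =
    verbalSubgroup {v | ∀ f : ℕ → G, FreeGroup.lift f v = 1} (FreeGroup (Fin n)) := by
  apply le_antisymm
  · intro w hw
    refine Subgroup.subset_closure ⟨FreeGroup.map Fin.val w, fun f => ?_,
      -- The value `1` is never used: only letters below `n` occur.
      fun k => if h : k < n then FreeGroup.of ⟨k, h⟩ else 1, ?_⟩
    · have e : (FreeGroup.lift f).comp (FreeGroup.map Fin.val) =
          FreeGroup.lift fun i : Fin n => f i := by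
        ext i
        simp
      exact (DFunLike.congr_fun e w).trans (congrFun hw fun i => f i)
    · have e : (FreeGroup.lift fun k => if h : k < n then FreeGroup.of (⟨k, h⟩ : Fin n) else 1).comp
          (FreeGroup.map Fin.val) = MonoidHom.id (FreeGroup (Fin n)) := by
        ext i
        simp
      exact DFunLike.congr_fun e w
  · refine (Subgroup.closure_le _).2 ?_
    rintro _ ⟨v, hv, f, rfl⟩
    refine MonoidHom.mem_ker.2 (funext fun g => ?_)
    have e : (FreeGroup.lift g).comp (FreeGroup.lift f) =
        FreeGroup.lift fun k => FreeGroup.lift g (f k) := by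
      ext k
      simp
    exact (DFunLike.congr_fun e v).trans (hv _)

theorem isReducedFree_wordMapGroup (G : Type) [Group G] : IsReducedFree (wordMapGroup n G) :=
  ⟨Fin n, {v | ∀ f : ℕ → G, FreeGroup.lift f v = 1},
    ⟨(QuotientGroup.quotientKerEquivRange (wordMap n G)).symm.trans
      (QuotientGroup.quotientMulEquivOfEq (ker_wordMap n G))⟩⟩

end ReducedFree

/-- The group of two-variable word maps on the symmetric group of degree three is not nilpotent. -/
theorem not_isNilpotent_wordMapGroup_perm :
    ¬ Group.IsNilpotent (wordMapGroup 2 (Equiv.Perm (Fin 3))) := by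
  intro h
  -- A transposition and a 3-cycle generate `S₃`, so evaluation at this pair is onto.
  let a : Fin 2 → Equiv.Perm (Fin 3) := ![c[0, 1], finRotate 3]
  refine not_isNilpotent_perm_fin_three (Group.nilpotent_of_surjective (evalHom a) ?_)
  rw [← MonoidHom.range_eq_top, eq_top_iff,
    ← Equiv.Perm.closure_cycle_adjacent_swap (σ := finRotate 3) isCycle_finRotate
      support_finRotate 0]
  refine (Subgroup.closure_le _).2 ?_
  rintro _ (rfl | rfl)
  · exact ⟨varMap _ 1, varMap_apply 1 a⟩
  · refine ⟨varMap _ 0, (varMap_apply 0 a).trans ?_⟩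
    decide

end WordMaps

theorem mainTheorem10 :
    (∃ (G : Type) (_ : Group G),
      Finite G ∧ WordMaps.IsReducedFree G ∧ ¬ Group.IsNilpotent G) ∧
    (∀ (G : Type u) [Group G] [Finite G],
      WordMaps.IsReducedFree G → ¬ Group.IsNilpotent G →
        ∀ (n : ℕ) (hn : 2 ≤ n), ∃ w : WordMaps.wordMapGroup n G,
          Function.Surjective (w : (Fin n → G) → G) ∧
          ¬ WordMaps.IsUniform (w : (Fin n → G) → G) ∧
          WordMaps.IsHomImage w (WordMaps.varMap G ⟨0, by omega⟩) ∧
          WordMaps.IsHomImage (WordMaps.varMap G ⟨0, by omega⟩) w ∧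
          ¬ WordMaps.AreAutomorphic w (WordMaps.varMap G ⟨0, by omega⟩)) := by
  refine ⟨⟨WordMaps.wordMapGroup 2 (Equiv.Perm (Fin 3)), inferInstance, inferInstance,
    WordMaps.isReducedFree_wordMapGroup 2 _, WordMaps.not_isNilpotent_wordMapGroup_perm⟩, ?_⟩
  intro G _ _ _ hG n hn
  obtain ⟨N, z, y, hz, hzy⟩ := WordMaps.exists_collapsingWord_eq_one hG
  have h01 : (⟨1, by omega⟩ : Fin n) ≠ ⟨0, by omega⟩ := by simp
  let w := WordMaps.collapsingWord N (WordMaps.varMap G (⟨0, by omega⟩ : Fin n))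
    (WordMaps.varMap G ⟨1, by omega⟩)
  have hw (a : Fin n → G) : (w : (Fin n → G) → G) a =
      WordMaps.collapsingWord N (a ⟨0, by omega⟩) (a ⟨1, by omega⟩) := by
    rw [← WordMaps.evalHom_apply, WordMaps.map_collapsingWord, WordMaps.evalHom_apply,
      WordMaps.evalHom_apply, WordMaps.varMap_apply, WordMaps.varMap_apply]
  have hx : WordMaps.IsHomImage (WordMaps.varMap G ⟨0, by omega⟩) w := by
    refine ⟨WordMaps.substitution
      (Function.update 1 ⟨0, by omega⟩ (WordMaps.varMap G ⟨0, by omega⟩)), ?_⟩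
    rw [WordMaps.map_collapsingWord, WordMaps.substitution_varMap, WordMaps.substitution_varMap,
      Function.update_self, Function.update_of_ne h01, Pi.one_apply,
      WordMaps.collapsingWord_one_right]
  have hu : ¬ WordMaps.IsUniform (w : (Fin n → G) → G) := by
    refine WordMaps.not_isUniform_of_zero ⟨0, by omega⟩ (fun a ha => ?_)
      (a := Function.update (fun _ => y) ⟨0, by omega⟩ z) ?_ ?_
    · rw [hw, ha, WordMaps.collapsingWord_one_left]
    · rwa [Function.update_self]
    · rw [hw, Function.update_self, Function.update_of_ne h01, hzy]
  exact ⟨w, hx.surjective, hu, WordMaps.isHomImage_varMap w _, hx, fun h =>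
    hu fun g => (h.distribution_eq g).symm.trans (WordMaps.isUniform_varMap _ g)⟩
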